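/- For $n\ge 1$ let $S_n$ be the set of permutations of $\{1,\dots,n\}$. For a pattern $\tau\in S_3$ let $S_n(\tau)$ be the set of $\sigma\in S_n$ that avoid $\tau$, i.e. for which there are no indices $i_1<i_2<i_3$ such that, for all $j,k\in\{1,2,3\}$, $\sigma_{i_j}<\sigma_{i_k}$ if and only if $\tau_j<\tau_k$. For $q\in(0,1)$ let $P_n^q$ be the Mallows distribution on $S_n$, i.e. the probability measure $P_n^q(\sigma)=q^{\mathrm{inv}(\sigma)}/Z_n(q)$, where $\mathrm{inv}(\sigma)$ is the number of inversions of $\sigma$ and $Z_n(q)=\sum_{\sigma\in S_n}q^{\mathrm{inv}(\sigma)}$ is the normalization constant. Let $$F(x)=\begin{cases}\dfrac1{1-x}, & x\in[0,1),\\ \infty, & x\in\mathbb R\setminus[0,1),\end{cases}\qquad F(\infty)=\infty .$$ **Theorem.** Let $q\in(0,1)$. The limits $\lim_{n\to\infty}\big(P_n^q(S_n(312))\big)^{1/n}$ and $\lim_{n\to\infty}\big(P_n^q(S_n(231))\big)^{1/n}$ exist and are equal, and the following hold. (i) If for some $c\in(0,1]$ one has $$F\Big(cF\big(cq\cdots F\big(cq^{N-1}(1+cq^N)\big)\cdots\big)\Big)=\infty\quad\text{for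 some integer } N\ge1,$$ where the left-hand side has $N$ nested occurrences of $F$, with factors $c,cq,\dots,cq^{N-1}$ from the outside in, then $$\lim_{n\to\infty}\big(P_n^q(S_n(312))\big)^{1/n}=\lim_{n\to\infty}\big(P_n^q(S_n(231))\big)^{1/n}>\frac{1-q}c .$$ (ii) If for some $c\in(0,1)$ one has $$F\Big(cF\big(cq\cdots F\big(cq^{N-1}F\big(c\tfrac{q^N}{1-q}\big)\big)\cdots\big)\Big)<\infty\quad\text{for some integer } N\ge1, \qquad(*)$$ where the left-hand side has $N+1$ nested occurrences of $F$, then $$\lim_{n\to\infty}\big(P_n^q(S_n(312))\big)^{1/n}=\lim_{n\to\infty}\big(P_n^q(S_n(231))\big)^{1/n}<\frac{1-q}c .\qquad(**)$$ Moreover, if $c\in(0,1)$ and for some fixed $N\ge1$ the inequality in $(*)$ holds with $c$ replaced by $b$ for values $b<c$ arbitrarily close to $c$, then $(**)$ still holds with $c$. -/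

import Mathlib

open Filter Topology

noncomputable section

namespace MallowsPattern

/-- The permutation `σ` of `Fin n` contains the pattern `τ`: some subsequence
`σ (i 0), σ (i 1), …` (with `i` strictly increasing) is in the same relative order
as `τ 0, τ 1, …`. -/
def Contains {m n : ℕ} (τ : Equiv.Perm (Fin m)) (σ : Equiv.Perm (Fin n)) : Prop :=
  ∃ i : Fin m → Fin n, StrictMono i ∧ ∀ j k : Fin m, σ (i j) < σ (i k) ↔ τ j < τ k

/-- The set `S_n(τ)` of permutations of `n` letters that avoid the pattern `τ`. -/
def avoiders {m : ℕ} (n : ℕ) (τ : Equiv.Perm (Fin m)) : Set (Equiv.Perm (Fin n)) :=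
  {σ | ¬ Contains τ σ}

/-- The number of inversions of `σ`. -/
def inv {n : ℕ} (σ : Equiv.Perm (Fin n)) : ℕ :=
  (Finset.univ.filter fun p : Fin n × Fin n => p.1 < p.2 ∧ σ p.2 < σ p.1).card

/-- The normalization constant of the Mallows distribution. -/
def mallowsZ (n : ℕ) (q : ℝ) : ℝ :=
  ∑ σ : Equiv.Perm (Fin n), q ^ inv σ

/-- The Mallows probability of a single permutation. -/
def mallowsMass (n : ℕ) (q : ℝ) (σ : Equiv.Perm (Fin n)) : ℝ :=
  q ^ inv σ / mallowsZ n q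

/-- The Mallows probability of a set of permutations. -/
def mallowsProb (n : ℕ) (q : ℝ) (A : Set (Equiv.Perm (Fin n))) : ℝ :=
  ∑ σ : Equiv.Perm (Fin n), A.indicator (mallowsMass n q) σ

/-- The permutation `312` (one-line notation; letters shifted to `0, 1, 2`). -/
def perm312 : Equiv.Perm (Fin 3) where
  toFun := ![2, 0, 1]
  invFun := ![1, 2, 0]
  left_inv := by decide
  right_inv := by decide

/-- The permutation `231` (one-line notation; letters shifted to `0, 1, 2`). -/
def perm231 : Equiv.Perm (Fin 3) where
  toFun := ![1, 2, 0]
  invFun := ![2, 0, 1]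
  left_inv := by decide
  right_inv := by decide

open scoped Classical in
/-- `F x = 1 / (1 - x)` for real `x ∈ [0, 1)` and `F x = ∞` otherwise
(also at `x = ∞`, so that `F` can be iterated). -/
def F (x : EReal) : EReal :=
  if 0 ≤ x ∧ x < 1 then ((1 / (1 - x.toReal) : ℝ) : EReal) else ⊤

/-- The nested iterate `F (c * F (c * q * F (⋯ F (c * q ^ (N - 1) * x) ⋯ )))` with `N`
occurrences of `F`. -/
def nestedF (q c : ℝ) : ℕ → EReal → EReal
  | 0, x => x
  | N + 1, x => nestedF q c N (F (((c * q ^ N : ℝ) : EReal) * x))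

/-- `F (c * F (c * q * ⋯ F (c * q ^ (N - 1) * (1 + c * q ^ N)) ⋯ ))`. -/
def lowerIterate (q c : ℝ) (N : ℕ) : EReal :=
  nestedF q c N ((1 + c * q ^ N : ℝ) : EReal)

/-- `F (c * F (c * q * ⋯ F (c * q ^ (N - 1) * F (c * q ^ N / (1 - q))) ⋯ ))`. -/
def upperIterate (q c : ℝ) (N : ℕ) : EReal :=
  nestedF q c N (F ((c * (q ^ N / (1 - q)) : ℝ) : EReal))

end MallowsPattern

end

/-! Let `A n` be the inversion generating function of the 312-avoiders. The value 0 at position `p`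
forces smaller values to its left and larger ones to its right, so `A (n+1) = ∑ q^i A i A (n-i)`,
and `G(z) = ∑ A n z^n` satisfies `G(z) = F(z G(qz))` inside its radius of convergence `r`. `A` is
supermultiplicative, so `A n ^ (1/n) → 1/r`, while the normalization grows like `(1-q)^(-n)`; hence
the limit is `(1-q)/r`. Inversion of permutations preserves `inv` and exchanges 231 with 312. It
remains to compare `c` with `r`.

The radius is pinned down by `r G(qr) = 1` (`radius_mul_genFun`). Unfolding `G = F(z G(qz))` gives
the nested iterates, seeded with a bound for `G` instead of `G` itself. For `c ≤ r` the seed `1 +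
cq^N` lies below `G(cq^N)`, so the iterate is finite (`lowerIterate_lt_top`); contraposition gives
(i). For the upper bound, suppose `r ≤ c`. The seed `1/(1-q)` exceeds `G(rq^(N+1))` by a fixed
amount, and `F` does not shrink this excess (`mul_genFun_add_lt_one`). Finiteness for all `b < r`
then forces `r G(qr) < 1` in the limit, a contradiction (`lt_radius_of_upperIterate`). -/

namespace MallowsPattern

/-! ### Inversions and 312-avoidance for maps between finite linear orders. -/

section Combinatorics

variable {α β α' β' : Type*} [LinearOrder α] [LinearOrder β] [LinearOrder α'] [LinearOrder β']

/-- The number of inversions of a map between finite linear orders. -/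
def invCount [Fintype α] (f : α → β) : ℕ :=
  ∑ x : α, ∑ y : α, if x < y ∧ f y < f x then 1 else 0

/-- A map between linear orders avoids the pattern `312`. -/
def Avoids312 (f : α → β) : Prop :=
  ∀ a b c : α, a < b → b < c → f b < f c → ¬ f c < f a

open scoped Classical in
/-- The inversion weight of a map, set to zero if the map contains `312`. -/
noncomputable def avoidWeight [Fintype α] (q : ℝ) (f : α → β) : ℝ :=
  if Avoids312 f then q ^ invCount f else 0

lemma invCount_congr [Fintype α] [Fintype α'] (a : α ≃o α') (b : β ≃o β') (e : α → β) :
    invCount (fun x => b (e (a.symm x))) = invCount e := by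
  unfold invCount
  rw [← a.toEquiv.sum_comp]
  refine Finset.sum_congr rfl fun x _ => ?_
  rw [← a.toEquiv.sum_comp]
  simp

lemma avoids312_congr (a : α ≃o α') (b : β ≃o β') (e : α → β) :
    Avoids312 (fun x => b (e (a.symm x))) ↔ Avoids312 e := by
  unfold Avoids312
  simp only [OrderIso.lt_iff_lt]
  constructor
  · intro h x y z
    simpa using h (a x) (a y) (a z)
  · intro h x y z hxy hyz
    exact h _ _ _ (by simpa using hxy) (by simpa using hyz)

lemma avoidWeight_congr [Fintype α] [Fintype α'] (q : ℝ) (a : α ≃o α') (b : β ≃o β') (e : α → β) :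
    avoidWeight q (fun x => b (e (a.symm x))) = avoidWeight q e := by
  unfold avoidWeight
  classical
  rw [invCount_congr]
  exact if_congr (avoids312_congr a b e) rfl rfl

/-- The inversion generating function of the `312`-avoiding permutations. -/
noncomputable def avoidSum (q : ℝ) (n : ℕ) : ℝ :=
  ∑ e : Fin n ≃ Fin n, avoidWeight q e

/-- The inversion generating function of all permutations. -/
noncomputable def invSum (q : ℝ) (n : ℕ) : ℝ :=
  ∑ e : Fin n ≃ Fin n, q ^ invCount e

/-- The blocks of a decomposed permutation are bijections between subtypes; order-preserving
relabelling returns them to `Fin n`. -/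
lemma sum_avoidWeight_eq [Fintype α] [Fintype β] (q : ℝ) {n : ℕ} (hα : Fintype.card α = n) (hβ : Fintype.card β = n) :
    ∑ e : α ≃ β, avoidWeight q e = avoidSum q n := by
  let a := (Fintype.orderIsoFinOfCardEq α hα).symm
  let b := (Fintype.orderIsoFinOfCardEq β hβ).symm
  unfold avoidSum
  rw [← (Equiv.equivCongr a.toEquiv b.toEquiv).sum_comp]
  exact Finset.sum_congr rfl fun e _ => (avoidWeight_congr q a b e).symm

lemma sum_invCount_eq [Fintype α] [Fintype β] (q : ℝ) {n : ℕ} (hα : Fintype.card α = n) (hβ : Fintype.card β = n) :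
    ∑ e : α ≃ β, q ^ invCount e = invSum q n := by
  let a := (Fintype.orderIsoFinOfCardEq α hα).symm
  let b := (Fintype.orderIsoFinOfCardEq β hβ).symm
  unfold invSum
  rw [← (Equiv.equivCongr a.toEquiv b.toEquiv).sum_comp]
  exact Finset.sum_congr rfl fun e _ => congrArg (q ^ ·) (invCount_congr a b e).symm

lemma sum_split_ne [Fintype α] {M : Type*} [AddCommMonoid M] (p : α) (h : α → M) :
    ∑ x, h x = h p + ∑ x : {x // x ≠ p}, h x := by
  rw [Fintype.sum_eq_add_sum_compl p]
  congr 1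
  exact Finset.sum_subtype _ (by simp) h

lemma sum_split_lt [Fintype α] {M : Type*} [AddCommMonoid M] (p : α) (h : α → M) :
    ∑ x, h x = ∑ x : {x // x < p}, h x + (h p + ∑ x : {x // p < x}, h x) := by
  rw [← Finset.sum_filter_add_sum_filter_not Finset.univ (fun x => x < p)]
  congr 1
  · exact Finset.sum_subtype _ (by simp) h
  · have : Finset.univ.filter (fun x => ¬ x < p)
        = insert p (Finset.univ.filter (fun x => p < x)) := by
      ext x
      simp [le_iff_eq_or_lt, eq_comm]
    rw [this, Finset.sum_insert (by simp)]
    congr 1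
    exact Finset.sum_subtype _ (by simp) h

/-! ### Product formula for the normalization constant. -/

section InsertMin

variable {n : ℕ} (p : Fin (n + 1))

/-- Extend a bijection by sending `p` to `0`. -/
noncomputable def insertZero (e : {x // x ≠ p} ≃ {y : Fin (n + 1) // y ≠ 0}) :
    Fin (n + 1) ≃ Fin (n + 1) :=
  Equiv.ofBijective (fun x => if h : x ≠ p then (e ⟨x, h⟩ : Fin (n + 1)) else 0) <| by
    rw [← Finite.injective_iff_bijective]
    intro x y hxy
    by_cases hx : x = p <;> by_cases hy : y = p
    · rw [hx, hy]
    · simp [hx, hy] at hxy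
      exact absurd hxy.symm (e ⟨y, hy⟩).2
    · simp [hx, hy] at hxy
      exact absurd hxy (e ⟨x, hx⟩).2
    · simpa [hx, hy, Subtype.coe_inj] using hxy

variable {p}

lemma insertZero_ne (e : {x // x ≠ p} ≃ {y : Fin (n + 1) // y ≠ 0}) (x : {x // x ≠ p}) :
    insertZero p e x = e x := by
  simp [insertZero, x.2]

lemma insertZero_self (e : {x // x ≠ p} ≃ {y : Fin (n + 1) // y ≠ 0}) :
    insertZero p e p = 0 := by
  simp [insertZero]

lemma card_filter_lt_fin (p : Fin (n + 1)) :
    (Finset.univ.filter fun x => x < p).card = (p : ℕ) := by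
  rw [show (Finset.univ.filter fun x => x < p) = Finset.Iio p by ext; simp]
  simp

lemma card_lt_fin (p : Fin (n + 1)) : Fintype.card {x // x < p} = (p : ℕ) := by
  rw [Fintype.card_subtype, card_filter_lt_fin]

lemma card_gt_fin (p : Fin (n + 1)) : Fintype.card {x // p < x} = n - p := by
  rw [Fintype.card_subtype, show (Finset.univ.filter fun x => p < x) = Finset.Ioi p by ext; simp]
  simp

/-- The minimum at position `p` is inverted with exactly the `p` entries before it. -/
lemma invCount_insertZero (e : {x // x ≠ p} ≃ {y : Fin (n + 1) // y ≠ 0}) :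
    invCount (insertZero p e) = p + invCount e := by
  unfold invCount
  have h0 : ∀ x : {x // x ≠ p}, (0 : Fin (n + 1)) < e x := fun x => Fin.pos_of_ne_zero (e x).2
  rw [sum_split_ne p]
  simp only [sum_split_ne p (fun y => if _ < y ∧ insertZero p e y < _ then 1 else 0),
    insertZero_ne, insertZero_self, Finset.sum_add_distrib]
  have h1 : ∑ x : {x // x ≠ p}, (if (x : Fin (n + 1)) < p ∧ 0 < (e x : Fin (n + 1)) then 1 else 0)
      = (p : ℕ) := by
    simp only [h0, and_true]
    have := sum_split_ne p (fun x : Fin (n + 1) => if x < p then 1 else 0)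
    simp only [lt_irrefl, if_false, zero_add] at this
    rw [← this]
    simp [card_filter_lt_fin]
  simp [h1]

lemma sum_insertZero (q : ℝ) (p : Fin (n + 1)) :
    ∑ e : Fin (n + 1) ≃ Fin (n + 1) with e.symm 0 = p, q ^ invCount e
      = q ^ (p : ℕ) * invSum q n := by
  have hc : ∀ r : Fin (n + 1), Fintype.card {x // x ≠ r} = n := by intro r; simp
  rw [← sum_invCount_eq q (hc p) (hc 0), Finset.mul_sum]
  symm
  refine Finset.sum_of_injOn (insertZero p) ?_ ?_ ?_ ?_
  · intro e _ e' _ h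
    ext x
    rw [← insertZero_ne, ← insertZero_ne, h]
  · intro e _
    simp [Equiv.symm_apply_eq, insertZero_self]
  · intro e he hn
    exfalso
    simp only [Finset.mem_filter, Finset.mem_univ, true_and, Equiv.symm_apply_eq] at he
    apply hn
    refine ⟨e.subtypeEquiv (fun x => ?_), by simp, ?_⟩
    · rw [he, e.injective.ne_iff]
    · ext x
      by_cases hx : x = p
      · rw [hx, insertZero_self, he]
      · rw [show x = ((⟨x, hx⟩ : {x // x ≠ p}) : Fin (n + 1)) from rfl, insertZero_ne]
        rfl
  · intro e _
    rw [invCount_insertZero, pow_add]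

lemma invSum_succ (q : ℝ) (n : ℕ) :
    invSum q (n + 1) = (∑ i ∈ Finset.range (n + 1), q ^ i) * invSum q n := by
  conv_lhs => unfold invSum
  rw [← Finset.sum_fiberwise (g := fun e : Fin (n + 1) ≃ Fin (n + 1) => e.symm 0),
    Finset.sum_mul, Finset.sum_range]
  exact Finset.sum_congr rfl fun p _ => sum_insertZero q p

lemma invSum_eq_prod (q : ℝ) (n : ℕ) :
    invSum q n = ∏ k ∈ Finset.range n, ∑ i ∈ Finset.range (k + 1), q ^ i := by
  induction n with
  | zero => simp [invSum, invCount]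
  | succ n ih => rw [invSum_succ, ih, Finset.prod_range_succ, mul_comm]

end InsertMin

/-! ### Decomposition of 312-avoiders at the position of the minimum. -/

section Glue

variable {n : ℕ} {p : Fin (n + 1)}

/-- Glue two bijections to a permutation sending `p` to `0`, the positions left of `p` to the
values in `(0, p]`, and the positions right of `p` to the values above `p`. -/
noncomputable def glue (e₁ : {x // x < p} ≃ {y // 0 < y ∧ y ≤ p})
    (e₂ : {x // p < x} ≃ {y // p < y}) : Fin (n + 1) ≃ Fin (n + 1) :=
  Equiv.ofBijective (fun x => if h : x < p then (e₁ ⟨x, h⟩ : Fin (n + 1)) else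
      if h : p < x then (e₂ ⟨x, h⟩ : Fin (n + 1)) else 0) <| by
    rw [← Finite.injective_iff_bijective]
    intro x y hxy
    rcases lt_trichotomy x p with hx | hx | hx <;> rcases lt_trichotomy y p with hy | hy | hy
    · simpa [hx, hy, Subtype.coe_inj] using hxy
    · simp [hx, hy] at hxy
      exact absurd hxy (e₁ ⟨x, hx⟩).2.1.ne'
    · simp [hx, hy, hy.not_gt] at hxy
      exact absurd hxy ((e₁ ⟨x, hx⟩).2.2.trans_lt (e₂ ⟨y, hy⟩).2).ne
    · simp [hx, hy] at hxy
      exact absurd hxy (e₁ ⟨y, hy⟩).2.1.ne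
    · rw [hx, hy]
    · simp [hx, hy, hy.not_gt] at hxy
      exact absurd hxy ((Fin.zero_le _).trans_lt (e₂ ⟨y, hy⟩).2).ne
    · simp [hx, hy, hx.not_gt] at hxy
      exact absurd hxy ((e₁ ⟨y, hy⟩).2.2.trans_lt (e₂ ⟨x, hx⟩).2).ne'
    · simp [hx, hy, hx.not_gt] at hxy
      exact absurd hxy ((Fin.zero_le _).trans_lt (e₂ ⟨x, hx⟩).2).ne'
    · simpa [hx, hy, hx.not_gt, hy.not_gt, Subtype.coe_inj] using hxy

variable (e₁ : {x // x < p} ≃ {y // 0 < y ∧ y ≤ p}) (e₂ : {x // p < x} ≃ {y // p < y})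

lemma glue_left (x : {x // x < p}) : glue e₁ e₂ x = e₁ x := by
  simp [glue, x.2]

lemma glue_mid : glue e₁ e₂ p = 0 := by
  simp [glue]

lemma glue_right (x : {x // p < x}) : glue e₁ e₂ x = e₂ x := by
  simp [glue, x.2, x.2.not_gt]

/-- Every left value is at most `p` and every right value exceeds it, so no inversion crosses the
blocks. -/
lemma invCount_glue :
    invCount (glue e₁ e₂) = p + invCount e₁ + invCount e₂ := by
  have hx : ∀ x : {x // x < p}, (0 : Fin (n + 1)) < e₁ x := fun x => (e₁ x).2.1
  have h1 : ∀ (x : {x // x < p}) (y : {x // p < x}), ¬ ((e₂ y : Fin (n + 1)) < e₁ x) :=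
    fun x y => ((e₁ x).2.2.trans_lt (e₂ y).2).not_gt
  have h2 : ∀ (x : {x // x < p}) (y : {x // p < x}), ¬ ((y : Fin (n + 1)) < x) :=
    fun x y => (x.2.trans y.2).not_gt
  have h3 : ∀ x : {x // x < p}, ¬ (p < (x : Fin (n + 1))) := fun x => x.2.not_gt
  have h4 : ∀ x : {x // p < x}, ¬ ((x : Fin (n + 1)) < p) := fun x => x.2.not_gt
  have h5 : ∀ x : {x // x < p}, (x : Fin (n + 1)) < p := fun x => x.2
  unfold invCount
  rw [sum_split_lt p]
  simp only [sum_split_lt p (fun y => if _ < y ∧ glue e₁ e₂ y < _ then 1 else 0),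
    glue_left, glue_mid, glue_right, Finset.sum_add_distrib]
  simp [hx, h1, h2, h3, h4, h5, card_lt_fin]
  ring

lemma avoids312_glue :
    Avoids312 (glue e₁ e₂) ↔ Avoids312 e₁ ∧ Avoids312 e₂ := by
  constructor
  · intro h
    constructor
    · intro a b c hab hbc h1 h2
      refine h a b c hab hbc ?_ ?_ <;> simpa only [glue_left] using by assumption
    · intro a b c hab hbc h1 h2
      refine h a b c hab hbc ?_ ?_ <;> simpa only [glue_right] using by assumption
  · rintro ⟨h1, h2⟩ a b c hab hbc hbc' hca
    have hl : ∀ x, x < p → glue e₁ e₂ x ≤ p := fun x hx => by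
      rw [show x = ((⟨x, hx⟩ : {x // x < p}) : Fin (n + 1)) from rfl, glue_left]
      exact (e₁ _).2.2
    have hr : ∀ x, p < x → p < glue e₁ e₂ x := fun x hx => by
      rw [show x = ((⟨x, hx⟩ : {x // p < x}) : Fin (n + 1)) from rfl, glue_right]
      exact (e₂ _).2
    have hm : glue e₁ e₂ p = 0 := glue_mid e₁ e₂
    rcases lt_trichotomy a p with ha | ha | ha
    · rcases lt_trichotomy c p with hc | hc | hc
      · refine h1 ⟨a, ha⟩ ⟨b, hbc.trans hc⟩ ⟨c, hc⟩ hab hbc ?_ ?_ <;>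
          simpa only [← Subtype.coe_lt_coe, ← glue_left e₁ e₂] using by assumption
      · rw [hc, hm] at hbc'
        exact absurd hbc' (Fin.not_lt_zero _)
      · exact absurd ((hl a ha).trans_lt (hr c hc)) hca.not_gt
    · rw [ha, hm] at hca
      exact absurd hca (Fin.not_lt_zero _)
    · refine h2 ⟨a, ha⟩ ⟨b, ha.trans hab⟩ ⟨c, ha.trans (hab.trans hbc)⟩ hab hbc ?_ ?_ <;>
        simpa only [← Subtype.coe_lt_coe, ← glue_right e₁ e₂] using by assumption

lemma avoidWeight_glue (q : ℝ) :
    avoidWeight q (glue e₁ e₂) = q ^ (p : ℕ) * (avoidWeight q e₁ * avoidWeight q e₂) := by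
  unfold avoidWeight
  rw [invCount_glue]
  by_cases h1 : Avoids312 e₁ <;> by_cases h2 : Avoids312 e₂ <;>
    simp [avoids312_glue, h1, h2, pow_add, mul_assoc]

/-- A value below `e x` placed after `p` would form a 312 with `x` and `p`. So all `e x` smaller
values occupy positions up to `p` other than `x`, of which there are `p`. -/
lemma Avoids312.le_of_lt {e : Fin (n + 1) ≃ Fin (n + 1)} (he : Avoids312 e) (hp : e p = 0)
    {x : Fin (n + 1)} (hx : x < p) : e x ≤ p := by
  have hsub : (Finset.Iio (e x)).map e.symm.toEmbedding ⊆ (Finset.Iic p).erase x := by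
    intro z hz
    simp only [Finset.mem_map, Finset.mem_Iio, Equiv.coe_toEmbedding] at hz
    obtain ⟨y, hy, rfl⟩ := hz
    simp only [Finset.mem_erase, Finset.mem_Iic, ne_eq, Equiv.symm_apply_eq]
    refine ⟨hy.ne, ?_⟩
    by_contra! hlt
    refine he x p _ hx hlt ?_ (by simpa using hy)
    rw [hp]
    refine Fin.pos_of_ne_zero fun h0 => ?_
    rw [← hp, e.injective.eq_iff] at h0
    exact hlt.ne' h0
  have := Finset.card_le_card hsub
  rw [Finset.card_map, Finset.card_erase_of_mem (by simpa using hx.le)] at this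
  simp at this
  exact this

/-- By avoidance, the `p + 1` values at positions up to `p` all lie below `e x`. -/
lemma Avoids312.lt_of_lt {e : Fin (n + 1) ≃ Fin (n + 1)} (he : Avoids312 e) (hp : e p = 0)
    {x : Fin (n + 1)} (hx : p < x) : p < e x := by
  have hsub : (Finset.Iic p).map e.toEmbedding ⊆ (Finset.Iio (e x)) := by
    intro z hz
    simp only [Finset.mem_map, Finset.mem_Iic, Equiv.coe_toEmbedding] at hz
    obtain ⟨y, hy, rfl⟩ := hz
    rw [Finset.mem_Iio]
    have hne : e y ≠ e x := e.injective.ne (hy.trans_lt hx).ne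
    refine lt_of_le_of_ne ?_ hne
    rcases hy.lt_or_eq with h | h
    · by_contra! hlt
      refine he y p x h hx ?_ hlt
      rw [hp]
      refine Fin.pos_of_ne_zero fun h0 => ?_
      rw [← hp, e.injective.eq_iff] at h0
      exact hx.ne' h0
    · rw [h, hp]
      exact Fin.zero_le _
  have := Finset.card_le_card hsub
  rw [Finset.card_map] at this
  simp at this
  rw [Fin.lt_def]
  omega

lemma Avoids312.exists_glue {e : Fin (n + 1) ≃ Fin (n + 1)} (he : Avoids312 e) (hp : e p = 0) :
    ∃ (e₁ : {x // x < p} ≃ {y // 0 < y ∧ y ≤ p}) (e₂ : {x // p < x} ≃ {y // p < y}),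
      glue e₁ e₂ = e := by
  have hpos : ∀ x, x ≠ p → 0 < e x := fun x hx =>
    Fin.pos_of_ne_zero fun h0 => hx (e.injective (h0.trans hp.symm))
  have hR : ∀ x, p < x ↔ p < e x := fun x => by
    refine ⟨he.lt_of_lt hp, fun h => ?_⟩
    rcases lt_trichotomy x p with hx | hx | hx
    · exact absurd (he.le_of_lt hp hx) h.not_ge
    · rw [hx, hp] at h
      exact absurd h (Fin.not_lt_zero _)
    · exact hx
  have hL : ∀ x, x < p ↔ 0 < e x ∧ e x ≤ p := fun x => by
    refine ⟨fun h => ⟨hpos x h.ne, he.le_of_lt hp h⟩, fun h => ?_⟩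
    rcases lt_trichotomy x p with hx | hx | hx
    · exact hx
    · rw [hx, hp] at h
      exact absurd h.1 (lt_irrefl _)
    · exact absurd h.2 (he.lt_of_lt hp hx).not_ge
  refine ⟨e.subtypeEquiv hL, e.subtypeEquiv hR, ?_⟩
  ext x
  rcases lt_trichotomy x p with hx | hx | hx
  · rw [show x = ((⟨x, hx⟩ : {x // x < p}) : Fin (n + 1)) from rfl, glue_left]
    rfl
  · rw [hx, glue_mid, hp]
  · rw [show x = ((⟨x, hx⟩ : {x // p < x}) : Fin (n + 1)) from rfl, glue_right]
    rfl

lemma sum_glue (q : ℝ) (p : Fin (n + 1)) :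
    ∑ e : Fin (n + 1) ≃ Fin (n + 1) with e.symm 0 = p, avoidWeight q e
      = q ^ (p : ℕ) * (avoidSum q p * avoidSum q (n - p)) := by
  have c1 : Fintype.card {x // x < p} = p := card_lt_fin p
  have c2 : Fintype.card {y : Fin (n + 1) // 0 < y ∧ y ≤ p} = p := by
    rw [Fintype.card_subtype]
    have : Finset.univ.filter (fun y : Fin (n + 1) => 0 < y ∧ y ≤ p) = Finset.Ioc 0 p := by
      ext; simp
    rw [this]
    simp
  have c3 : Fintype.card {y // p < y} = n - p := card_gt_fin p
  rw [← sum_avoidWeight_eq q c1 c2, ← sum_avoidWeight_eq q c3 c3, Finset.sum_mul_sum,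
    ← Finset.sum_product', Finset.mul_sum]
  symm
  refine Finset.sum_of_injOn (fun e => glue e.1 e.2) ?_ ?_ ?_ ?_
  · rintro ⟨e₁, e₂⟩ _ ⟨e₁', e₂'⟩ _ h
    change glue e₁ e₂ = glue e₁' e₂' at h
    refine Prod.ext (Equiv.ext fun x => Subtype.ext ?_) (Equiv.ext fun x => Subtype.ext ?_)
    · rw [← glue_left e₁ e₂, h, glue_left]
    · rw [← glue_right e₁ e₂, h, glue_right]
  · intro e _
    simp [Equiv.symm_apply_eq, glue_mid]
  -- Gluing only needs to reach the avoiders: the permutations it misses have weight zero.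
  · intro e he hn
    simp only [Finset.mem_filter, Finset.mem_univ, true_and, Equiv.symm_apply_eq] at he
    by_contra hne
    have hav : Avoids312 e := by
      by_contra h
      exact hne (by simp [avoidWeight, h])
    obtain ⟨e₁, e₂, h⟩ := hav.exists_glue he.symm
    exact hn ⟨(e₁, e₂), by simp, h⟩
  · intro e _
    exact (avoidWeight_glue e.1 e.2 q).symm

lemma avoidSum_succ (q : ℝ) (n : ℕ) :
    avoidSum q (n + 1)
      = ∑ i ∈ Finset.range (n + 1), q ^ i * (avoidSum q i * avoidSum q (n - i)) := by
  conv_lhs => unfold avoidSum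
  rw [← Finset.sum_fiberwise (g := fun e : Fin (n + 1) ≃ Fin (n + 1) => e.symm 0),
    Finset.sum_range]
  exact Finset.sum_congr rfl fun p _ => sum_glue q p

lemma avoidSum_zero (q : ℝ) : avoidSum q 0 = 1 := by
  simp [avoidSum, avoidWeight, invCount, Avoids312]

end Glue

/-! ### Mallows probabilities of the two avoidance classes. -/

lemma avoidSum_le_invSum {q : ℝ} (hq : 0 ≤ q) (n : ℕ) : avoidSum q n ≤ invSum q n := by
  refine Finset.sum_le_sum fun e _ => ?_
  unfold avoidWeight
  split_ifs
  · exact le_rfl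
  · positivity

lemma inv_eq_invCount {n : ℕ} (σ : Equiv.Perm (Fin n)) : inv σ = invCount σ := by
  unfold inv invCount
  rw [Finset.card_filter, Fintype.sum_prod_type]

lemma mallowsZ_eq (n : ℕ) (q : ℝ) : mallowsZ n q = invSum q n := by
  unfold mallowsZ invSum
  simp only [inv_eq_invCount]

lemma contains_perm312_iff {n : ℕ} (σ : Equiv.Perm (Fin n)) :
    Contains perm312 σ ↔ ¬ Avoids312 σ := by
  unfold Avoids312
  push Not
  constructor
  · rintro ⟨i, hi, h⟩
    exact ⟨i 0, i 1, i 2, hi (by decide), hi (by decide), (h 1 2).2 (by decide),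
      (h 2 0).2 (by decide)⟩
  · rintro ⟨a, b, c, hab, hbc, h1, h2⟩
    refine ⟨![a, b, c], ?_, ?_⟩
    · rw [Fin.strictMono_iff_lt_succ]
      intro j
      fin_cases j
      · exact hab
      · exact hbc
    · intro j k
      fin_cases j <;> fin_cases k <;>
        simp [perm312, h1, h2, h1.le, h2.le, h1.trans h2, (h1.trans h2).le]

/-- The patterns 231 and 312 are inverse to each other, and inverting swaps positions with values.
-/
lemma contains_perm231_iff {n : ℕ} (σ : Equiv.Perm (Fin n)) :
    Contains perm231 σ ↔ ¬ Avoids312 σ.symm := by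
  unfold Avoids312
  push Not
  constructor
  · rintro ⟨i, hi, h⟩
    exact ⟨σ (i 2), σ (i 0), σ (i 1), (h 2 0).2 (by decide), (h 0 1).2 (by decide),
      by simpa using hi (show (0 : Fin 3) < 1 by decide),
      by simpa using hi (show (1 : Fin 3) < 2 by decide)⟩
  · rintro ⟨a, b, c, hab, hbc, h1, h2⟩
    refine ⟨![σ.symm b, σ.symm c, σ.symm a], ?_, ?_⟩
    · rw [Fin.strictMono_iff_lt_succ]
      intro j
      fin_cases j
      · exact h1
      · exact h2
    · intro j k
      fin_cases j <;> fin_cases k <;>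
        simp [perm231, hab, hbc, hab.le, hbc.le, hab.trans hbc, (hab.trans hbc).le]

lemma invCount_symm {n : ℕ} (σ : Equiv.Perm (Fin n)) : invCount σ.symm = invCount σ := by
  unfold invCount
  rw [← Equiv.sum_comp σ]
  have h : ∀ a, ∑ y, (if σ a < y ∧ σ.symm y < σ.symm (σ a) then 1 else 0)
      = ∑ b, if σ a < σ b ∧ b < a then 1 else 0 := fun a => by
    rw [← Equiv.sum_comp σ]
    simp
  rw [Finset.sum_congr rfl fun a _ => h a, Finset.sum_comm]
  simp only [and_comm]

lemma mallowsProb_perm312 (n : ℕ) (q : ℝ) :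
    mallowsProb n q (avoiders n perm312) = avoidSum q n / invSum q n := by
  unfold mallowsProb avoidSum mallowsMass
  rw [Finset.sum_div]
  refine Finset.sum_congr rfl fun σ _ => ?_
  classical
  simp only [Set.indicator_apply, avoiders, Set.mem_ofPred_eq, contains_perm312_iff, not_not,
    avoidWeight, ite_div, zero_div, mallowsZ_eq, inv_eq_invCount]

lemma mallowsProb_perm231 (n : ℕ) (q : ℝ) :
    mallowsProb n q (avoiders n perm231) = avoidSum q n / invSum q n := by
  unfold mallowsProb avoidSum mallowsMass
  rw [Finset.sum_div, ← Equiv.sum_comp (Equiv.inv (Equiv.Perm (Fin n))) (fun e => avoidWeight q e / invSum q n)]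
  refine Finset.sum_congr rfl fun σ _ => ?_
  classical
  simp only [Set.indicator_apply, avoiders, Set.mem_ofPred_eq, contains_perm231_iff, not_not,
    avoidWeight, ite_div, zero_div, mallowsZ_eq, inv_eq_invCount, Equiv.inv_apply,
    ← Equiv.Perm.inv_def]
  rw [show invCount (σ⁻¹ : Equiv.Perm (Fin n)) = invCount σ from invCount_symm σ]

end Combinatorics

end MallowsPattern

namespace MallowsPattern

/-! ### Exponential growth rates. -/

section Growth

variable {q : ℝ}

lemma one_le_avoidSum (hq0 : 0 ≤ q) (n : ℕ) : 1 ≤ avoidSum q n := by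
  induction n using Nat.strong_induction_on with
  | _ n ih =>
    rcases n with _ | n
    · rw [avoidSum_zero]
    · rw [avoidSum_succ, Finset.sum_range_succ']
      have h1 : 0 ≤ ∑ i ∈ Finset.range n,
          q ^ (i + 1) * (avoidSum q (i + 1) * avoidSum q (n - (i + 1))) := by
        refine Finset.sum_nonneg fun i hi => ?_
        have := ih (i + 1) (by simpa using hi)
        have := ih (n - (i + 1)) (by omega)
        positivity
      have h2 := ih n (by omega)
      simp only [pow_zero, avoidSum_zero, Nat.sub_zero, one_mul]
      linarith

lemma avoidSum_pos (hq0 : 0 ≤ q) (n : ℕ) : 0 < avoidSum q n :=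
  zero_lt_one.trans_le (one_le_avoidSum hq0 n)

/-- Induction on `m`: the first `m + 1` terms of the recursion for `m + 1 + n` already dominate the
product, by the hypothesis at `m - i`. -/
lemma avoidSum_mul_le (hq0 : 0 ≤ q) (m n : ℕ) :
    avoidSum q m * avoidSum q n ≤ avoidSum q (m + n) := by
  have hpos := avoidSum_pos hq0
  induction m using Nat.strong_induction_on with
  | _ m ih =>
    rcases m with _ | m
    · simp [avoidSum_zero]
    · rw [Nat.add_right_comm, avoidSum_succ, avoidSum_succ, Finset.sum_mul]
      calc _ ≤ ∑ i ∈ Finset.range (m + 1),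
            q ^ i * (avoidSum q i * avoidSum q (m + n - i)) := by
            refine Finset.sum_le_sum fun i hi => ?_
            have hi' : i ≤ m := by simpa [Nat.lt_succ_iff] using hi
            rw [mul_assoc, mul_assoc, show m + n - i = m - i + n by omega]
            have := ih (m - i) (by omega)
            have := (hpos i).le
            gcongr
        _ ≤ _ := by
            refine Finset.sum_le_sum_of_subset_of_nonneg ?_ fun i _ _ => ?_
            · exact Finset.range_subset_range.2 (by omega)
            · have := hpos i
              have := hpos (m + n - i)
              positivity

lemma geom_sum_le (hq0 : 0 ≤ q) (hq1 : q < 1) (n : ℕ) :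
    ∑ i ∈ Finset.range n, q ^ i ≤ (1 - q)⁻¹ := by
  rw [← tsum_geometric_of_lt_one hq0 hq1]
  exact (summable_geometric_of_lt_one hq0 hq1).sum_le_tsum _ fun i _ => by positivity

lemma geom_sum_succ_pos (hq0 : 0 ≤ q) (n : ℕ) : 0 < ∑ i ∈ Finset.range (n + 1), q ^ i := by
  rw [Finset.sum_range_succ']
  have : 0 ≤ ∑ i ∈ Finset.range n, q ^ (i + 1) := Finset.sum_nonneg fun i _ => by positivity
  simp only [pow_zero]
  linarith

lemma invSum_pos (hq0 : 0 ≤ q) (n : ℕ) : 0 < invSum q n := by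
  rw [invSum_eq_prod]
  exact Finset.prod_pos fun i _ => geom_sum_succ_pos hq0 i

lemma invSum_le (hq0 : 0 ≤ q) (hq1 : q < 1) (n : ℕ) : invSum q n ≤ (1 - q)⁻¹ ^ n := by
  rw [invSum_eq_prod]
  calc _ ≤ ∏ _k ∈ Finset.range n, (1 - q)⁻¹ :=
        Finset.prod_le_prod (fun i _ => (geom_sum_succ_pos hq0 i).le)
          fun i _ => geom_sum_le hq0 hq1 _
    _ = _ := by simp

/-- The logarithm of the product formula, divided by `n`, is a Cesàro mean of logarithms of partial
geometric sums. -/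
lemma tendsto_log_invSum (hq0 : 0 ≤ q) (hq1 : q < 1) :
    Tendsto (fun n : ℕ => Real.log (invSum q n) / n) atTop (𝓝 (Real.log (1 - q)⁻¹)) := by
  have h : Tendsto (fun k : ℕ => Real.log (∑ i ∈ Finset.range (k + 1), q ^ i)) atTop
      (𝓝 (Real.log (1 - q)⁻¹)) := by
    have h1 : (1 - q)⁻¹ ≠ 0 := inv_ne_zero (by linarith)
    exact ((Real.continuousAt_log h1).tendsto.comp
      (hasSum_geometric_of_lt_one hq0 hq1).tendsto_sum_nat).comp (tendsto_add_atTop_nat 1)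
  refine h.cesaro.congr fun n => ?_
  rw [invSum_eq_prod, Real.log_prod fun i _ => (geom_sum_succ_pos hq0 i).ne', div_eq_inv_mul]

/-- Fekete's lemma for `-log (avoidSum q n)`; comparison with `invSum` supplies the bound. -/
lemma exists_growth_rate (hq0 : 0 ≤ q) (hq1 : q < 1) :
    ∃ l : ℝ, l ≤ Real.log (1 - q)⁻¹ ∧
      Tendsto (fun n : ℕ => Real.log (avoidSum q n) / n) atTop (𝓝 l) ∧
      ∀ n : ℕ, Real.log (avoidSum q n) ≤ n * l := by
  have hsub : Subadditive fun n => -Real.log (avoidSum q n) := fun m n => by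
    have h := Real.log_le_log (mul_pos (avoidSum_pos hq0 m) (avoidSum_pos hq0 n))
      (avoidSum_mul_le hq0 m n)
    rw [Real.log_mul (avoidSum_pos hq0 m).ne' (avoidSum_pos hq0 n).ne'] at h
    linarith
  have hle : ∀ n : ℕ, Real.log (avoidSum q n) / n ≤ Real.log (1 - q)⁻¹ := fun n => by
    rcases Nat.eq_zero_or_pos n with rfl | hn
    · have h : 1 ≤ (1 - q)⁻¹ := by simpa using geom_sum_le hq0 hq1 1
      simpa only [Nat.cast_zero, div_zero] using Real.log_nonneg h
    · rw [div_le_iff₀ (by exact_mod_cast hn), mul_comm, ← Real.log_pow]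
      exact Real.log_le_log (avoidSum_pos hq0 n)
        ((avoidSum_le_invSum hq0 n).trans (invSum_le hq0 hq1 n))
  have hbdd : BddBelow (Set.range fun n : ℕ => -Real.log (avoidSum q n) / n) := by
    refine ⟨-Real.log (1 - q)⁻¹, ?_⟩
    rintro _ ⟨n, rfl⟩
    simpa only [neg_div] using neg_le_neg (hle n)
  have ht := (hsub.tendsto_lim hbdd).neg
  simp only [neg_div, neg_neg] at ht
  refine ⟨-hsub.lim, le_of_tendsto' ht hle, ht, fun n => ?_⟩
  rcases Nat.eq_zero_or_pos n with rfl | hn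
  · simp [avoidSum_zero]
  · have h := hsub.lim_le_div hbdd hn.ne'
    rw [le_div_iff₀ (by exact_mod_cast hn)] at h
    linarith

/-- `r` is the radius of convergence of the generating function of `avoidSum q`. -/
structure IsRadius (q r : ℝ) : Prop where
  one_sub_le : 1 - q ≤ r
  tendsto_log : Tendsto (fun n : ℕ => Real.log (avoidSum q n) / n) atTop (𝓝 (Real.log r⁻¹))
  avoidSum_le (n : ℕ) : avoidSum q n ≤ r⁻¹ ^ n

lemma exists_isRadius (hq0 : 0 ≤ q) (hq1 : q < 1) : ∃ r, IsRadius q r := by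
  obtain ⟨l, h1, h2, h3⟩ := exists_growth_rate hq0 hq1
  have hl : (Real.exp (-l))⁻¹ = Real.exp l := by rw [Real.exp_neg, inv_inv]
  refine ⟨Real.exp (-l), ?_, ?_, fun n => ?_⟩
  · rw [Real.log_inv] at h1
    rw [← Real.exp_log (show 0 < 1 - q by linarith)]
    exact Real.exp_le_exp.2 (by linarith)
  · rwa [hl, Real.log_exp]
  · rw [hl, ← Real.exp_nat_mul, ← Real.log_le_iff_le_exp (avoidSum_pos hq0 n)]
    exact h3 n

lemma IsRadius.tendsto_prob {r : ℝ} (hr : IsRadius q r) (hq0 : 0 ≤ q) (hq1 : q < 1) :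
    Tendsto (fun n : ℕ => (avoidSum q n / invSum q n) ^ ((1 : ℝ) / (n : ℝ))) atTop
      (𝓝 ((1 - q) / r)) := by
  have hr0 : 0 < r := by linarith [hr.one_sub_le]
  have h := (Real.continuous_exp.tendsto _).comp
    (hr.tendsto_log.sub (tendsto_log_invSum hq0 hq1))
  have hlim : Real.exp (Real.log r⁻¹ - Real.log (1 - q)⁻¹) = (1 - q) / r := by
    have h1 : (0 : ℝ) < 1 - q := by linarith
    rw [Real.exp_sub, Real.exp_log (by positivity), Real.exp_log (by positivity)]
    field_simp
  rw [hlim] at h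
  refine h.congr fun n => ?_
  have ha := avoidSum_pos hq0 n
  have hi := invSum_pos hq0 n
  rw [Real.rpow_def_of_pos (by positivity), Real.log_div ha.ne' hi.ne']
  simp only [Function.comp]
  congr 1
  ring

end Growth

/-! ### The functional equation and the equation for the radius. -/

section GeneratingFunction

variable {q r : ℝ}

/-- The generating function of `avoidSum q`. -/
noncomputable def genFun (q z : ℝ) : ℝ := ∑' n, avoidSum q n * z ^ n

lemma IsRadius.pos (hr : IsRadius q r) (hq1 : q < 1) : 0 < r := by
  linarith [hr.one_sub_le]

lemma IsRadius.summable (hr : IsRadius q r) (hq0 : 0 ≤ q) (hq1 : q < 1) {z : ℝ} (hz0 : 0 ≤ z)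
    (hz : z < r) : Summable fun n => avoidSum q n * z ^ n := by
  have hr0 := hr.pos hq1
  refine Summable.of_nonneg_of_le (fun n => ?_) (fun n => ?_)
    (summable_geometric_of_lt_one (show 0 ≤ z / r by positivity) ((div_lt_one hr0).2 hz))
  · have := avoidSum_pos hq0 n
    positivity
  · rw [div_pow, div_eq_inv_mul, ← inv_pow]
    have := hr.avoidSum_le n
    gcongr

lemma IsRadius.le_of_bounded (hr : IsRadius q r) (hq0 : 0 ≤ q) (hq1 : q < 1) {z K : ℝ}
    (hz0 : 0 < z) (h : ∀ n, avoidSum q n * z ^ n ≤ K) : z ≤ r := by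
  have hr0 := hr.pos hq1
  have hK : 0 < K := lt_of_lt_of_le (by simp [avoidSum_zero]) (h 0)
  have h1 : Tendsto (fun n : ℕ => Real.log K / n - Real.log z) atTop (𝓝 (0 - Real.log z)) :=
    (tendsto_const_div_atTop_nhds_zero_nat _).sub_const _
  have h2 : Real.log r⁻¹ ≤ 0 - Real.log z := by
    refine le_of_tendsto_of_tendsto hr.tendsto_log h1 ?_
    filter_upwards [eventually_gt_atTop 0] with n hn
    have hn' : (0 : ℝ) < n := by exact_mod_cast hn
    have ha := avoidSum_pos hq0 n
    have := Real.log_le_log (by positivity) (h n)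
    rw [Real.log_mul ha.ne' (by positivity), Real.log_pow] at this
    rw [div_le_iff₀ hn', sub_mul, div_mul_cancel₀ _ hn'.ne']
    linarith
  rw [Real.log_inv] at h2
  exact (Real.log_le_log_iff hz0 hr0).1 (by linarith)

lemma one_le_genFun (hr : IsRadius q r) (hq0 : 0 ≤ q) (hq1 : q < 1) {z : ℝ} (hz0 : 0 ≤ z)
    (hz : z < r) : 1 ≤ genFun q z := by
  have := (hr.summable hq0 hq1 hz0 hz).sum_le_tsum (Finset.range 1) fun n _ => by
    have := avoidSum_pos hq0 n
    positivity
  simpa [genFun, avoidSum_zero] using this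

lemma avoidSum_one (q : ℝ) : avoidSum q 1 = 1 := by
  rw [avoidSum_succ]
  simp [avoidSum_zero]

lemma one_add_lt_genFun (hr : IsRadius q r) (hq0 : 0 ≤ q) (hq1 : q < 1) {z : ℝ} (hz0 : 0 < z)
    (hz : z < r) : 1 + z < genFun q z := by
  have := (hr.summable hq0 hq1 hz0.le hz).sum_le_tsum (Finset.range 3) fun n _ => by
    have := avoidSum_pos hq0 n
    positivity
  simp only [Finset.sum_range_succ, Finset.sum_range_zero, avoidSum_zero, avoidSum_one] at this
  have h2 : 0 < avoidSum q 2 * z ^ 2 := mul_pos (avoidSum_pos hq0 2) (by positivity)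
  unfold genFun
  linarith

lemma genFun_lt_genFun (hr : IsRadius q r) (hq0 : 0 ≤ q) (hq1 : q < 1) {w z : ℝ} (hw0 : 0 ≤ w)
    (hwz : w < z) (hz : z < r) : genFun q w < genFun q z := by
  refine Summable.tsum_lt_tsum (i := 1) (fun n => ?_) ?_
    (hr.summable hq0 hq1 hw0 (hwz.trans hz)) (hr.summable hq0 hq1 (hw0.trans hwz.le) hz)
  · have := (avoidSum_pos hq0 n).le
    gcongr
  · simpa [avoidSum_one] using hwz

lemma genFun_le_genFun (hr : IsRadius q r) (hq0 : 0 ≤ q) (hq1 : q < 1) {w z : ℝ} (hw0 : 0 ≤ w)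
    (hwz : w ≤ z) (hz : z < r) : genFun q w ≤ genFun q z := by
  rcases hwz.lt_or_eq with h | h
  · exact (genFun_lt_genFun hr hq0 hq1 hw0 h hz).le
  · rw [h]

lemma genFun_eq (hr : IsRadius q r) (hq0 : 0 ≤ q) (hq1 : q < 1) {z : ℝ} (hz0 : 0 ≤ z)
    (hz : z < r) : genFun q z = 1 + z * genFun q (q * z) * genFun q z := by
  have hqz : q * z < r := (mul_le_of_le_one_left hz0 hq1.le).trans_lt hz
  have h1 := hr.summable hq0 hq1 hz0 hz
  have h2 := hr.summable hq0 hq1 (mul_nonneg hq0 hz0) hqz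
  have hmul : genFun q (q * z) * genFun q z
      = ∑' n, ∑ k ∈ Finset.range (n + 1),
        (avoidSum q k * (q * z) ^ k) * (avoidSum q (n - k) * z ^ (n - k)) :=
    tsum_mul_tsum_eq_tsum_sum_range_of_summable_norm h2.norm h1.norm
  rw [mul_assoc, hmul, ← tsum_mul_left]
  conv_lhs => unfold genFun
  rw [h1.tsum_eq_zero_add]
  congr 1
  · simp [avoidSum_zero]
  · refine tsum_congr fun n => ?_
    rw [avoidSum_succ, Finset.sum_mul, Finset.mul_sum]
    refine Finset.sum_congr rfl fun i hi => ?_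
    have hi' : n = i + (n - i) := by
      have : i < n + 1 := by simpa using hi
      omega
    have hz' : z ^ (n + 1) = z ^ i * z ^ (n - i) * z := by
      rw [← pow_add, ← hi', pow_succ]
    rw [hz', mul_pow]
    ring

/-- Otherwise the functional equation would give `G(z) ≥ 1 + G(z)`. -/
lemma mul_genFun_lt_one (hr : IsRadius q r) (hq0 : 0 ≤ q) (hq1 : q < 1) {z : ℝ} (hz0 : 0 ≤ z)
    (hz : z < r) : z * genFun q (q * z) < 1 := by
  have h1 := genFun_eq hr hq0 hq1 hz0 hz
  have h2 := one_le_genFun hr hq0 hq1 hz0 hz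
  by_contra! h
  nlinarith

lemma genFun_eq_div (hr : IsRadius q r) (hq0 : 0 ≤ q) (hq1 : q < 1) {z : ℝ} (hz0 : 0 ≤ z)
    (hz : z < r) : genFun q z = 1 / (1 - z * genFun q (q * z)) := by
  have h1 := genFun_eq hr hq0 hq1 hz0 hz
  have h2 := mul_genFun_lt_one hr hq0 hq1 hz0 hz
  rw [eq_div_iff (by linarith)]
  linarith

lemma continuousAt_genFun (hr : IsRadius q r) (hq0 : 0 ≤ q) (hq1 : q < 1) {z : ℝ} (hz0 : 0 < z)
    (hz : z < r) : ContinuousAt (genFun q) z := by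
  obtain ⟨w, hzw, hwr⟩ := exists_between hz
  have hc : ContinuousOn (genFun q) (Set.Icc 0 w) := by
    refine continuousOn_tsum (fun n => by fun_prop)
      (hr.summable hq0 hq1 (hz0.trans hzw).le hwr) fun n x hx => ?_
    have := (avoidSum_pos hq0 n).le
    have := hx.1
    rw [Real.norm_of_nonneg (by positivity)]
    have := hx.2
    gcongr
  exact hc.continuousAt (Icc_mem_nhds hz0 hzw)

/-- The point `q * r` is interior to the disc of convergence, so nothing about `G` at `r` itself is
needed. -/
lemma continuousAt_mul_genFun (hr : IsRadius q r) (hq0 : 0 < q) (hq1 : q < 1) :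
    ContinuousAt (fun z => genFun q (q * z)) r := by
  have hr0 := hr.pos hq1
  have h := continuousAt_genFun hr hq0.le hq1 (mul_pos hq0 hr0)
    (mul_lt_of_lt_one_left hr0 hq1)
  exact ContinuousAt.comp (f := fun z => q * z) h (by fun_prop)

lemma le_one_of_frequently_lt {f : ℝ → ℝ} {r : ℝ} (hf : ContinuousAt f r)
    (h : ∃ᶠ z in 𝓝 r, f z < 1) : f r ≤ 1 := by
  by_contra! hlt
  obtain ⟨z, h1, h2⟩ := (h.and_eventually (hf.eventually (lt_mem_nhds hlt))).exists
  exact absurd h1 h2.not_gt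

lemma frequently_nhds_of_lt {r : ℝ} (hr : 0 < r) {P : ℝ → Prop}
    (h : ∀ z, 0 < z → z < r → P z) : ∃ᶠ z in 𝓝 r, P z := by
  have : ∃ᶠ z in 𝓝[<] r, P z := by
    refine Eventually.frequently ?_
    filter_upwards [Ioo_mem_nhdsLT hr] with z hz using h z hz.1 hz.2
  exact this.filter_mono nhdsWithin_le_nhds

lemma radius_mul_genFun_le_one (hr : IsRadius q r) (hq0 : 0 < q) (hq1 : q < 1) :
    r * genFun q (q * r) ≤ 1 := by
  refine le_one_of_frequently_lt (f := fun z => z * genFun q (q * z))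
    (continuousAt_id.mul (continuousAt_mul_genFun hr hq0 hq1))
    (frequently_nhds_of_lt (hr.pos hq1) fun z h1 h2 => ?_)
  exact mul_genFun_lt_one hr hq0.le hq1 h1.le h2

/-- Here `z` may exceed `r`. The partial sums satisfy `S n ≤ S (n+1) ≤ 1 + z G(qz) S n`, which
bounds them without assuming convergence. -/
lemma sum_avoidSum_le (hr : IsRadius q r) (hq0 : 0 ≤ q) (hq1 : q < 1) {z : ℝ} (hz0 : 0 ≤ z)
    (hz : q * z < r) (h : z * genFun q (q * z) < 1) (n : ℕ) :
    ∑ k ∈ Finset.range n, avoidSum q k * z ^ k ≤ 1 / (1 - z * genFun q (q * z)) := by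
  have hpos : ∀ k, 0 ≤ avoidSum q k * z ^ k := fun k => by
    have := avoidSum_pos hq0 k
    positivity
  have hposq : ∀ k, 0 ≤ avoidSum q k * (q * z) ^ k := fun k => by
    have := avoidSum_pos hq0 k
    positivity
  have hS := hr.summable hq0 hq1 (mul_nonneg hq0 hz0) hz
  have hstep : ∀ n, ∑ k ∈ Finset.range n, avoidSum q (k + 1) * z ^ (k + 1)
      ≤ z * (genFun q (q * z) * ∑ k ∈ Finset.range n, avoidSum q k * z ^ k) := by
    intro n
    calc _ = z * ∑ k ∈ Finset.range n, ∑ i ∈ Finset.range (k + 1),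
          (avoidSum q i * (q * z) ^ i) * (avoidSum q (k - i) * z ^ (k - i)) := by
          rw [Finset.mul_sum]
          refine Finset.sum_congr rfl fun k _ => ?_
          rw [avoidSum_succ, Finset.sum_mul, Finset.mul_sum]
          refine Finset.sum_congr rfl fun i hi => ?_
          have hi' : k = i + (k - i) := by
            have : i < k + 1 := by simpa using hi
            omega
          have hz' : z ^ (k + 1) = z ^ i * z ^ (k - i) * z := by
            rw [← pow_add, ← hi', pow_succ]
          rw [hz', mul_pow]
          ring
      _ ≤ _ := by
          refine mul_le_mul_of_nonneg_left ?_ hz0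
          rw [Finset.sum_range_diag_flip n
            (fun i j => (avoidSum q i * (q * z) ^ i) * (avoidSum q j * z ^ j))]
          calc _ ≤ ∑ i ∈ Finset.range n, ∑ j ∈ Finset.range n,
                (avoidSum q i * (q * z) ^ i) * (avoidSum q j * z ^ j) := by
                refine Finset.sum_le_sum fun i _ => ?_
                exact Finset.sum_le_sum_of_subset_of_nonneg
                  (Finset.range_subset_range.2 (Nat.sub_le _ _))
                  fun j _ _ => mul_nonneg (hposq i) (hpos j)
            _ = (∑ i ∈ Finset.range n, avoidSum q i * (q * z) ^ i)
                * ∑ k ∈ Finset.range n, avoidSum q k * z ^ k := by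
                rw [Finset.sum_mul_sum]
            _ ≤ _ := by
                refine mul_le_mul_of_nonneg_right (hS.sum_le_tsum _ fun i _ => hposq i) ?_
                exact Finset.sum_nonneg fun k _ => hpos k
  rw [le_div_iff₀ (by linarith)]
  have h1 : ∑ k ∈ Finset.range n, avoidSum q k * z ^ k
      ≤ ∑ k ∈ Finset.range (n + 1), avoidSum q k * z ^ k := by
    rw [Finset.sum_range_succ]
    linarith [hpos n]
  rw [Finset.sum_range_succ'] at h1
  simp only [pow_zero, avoidSum_zero, mul_one] at h1
  linarith [hstep n]

/-- A strict inequality would persist at some `z > r`, where `sum_avoidSum_le` would keep the terms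
`avoidSum q n * z ^ n` bounded. -/
lemma radius_mul_genFun (hr : IsRadius q r) (hq0 : 0 < q) (hq1 : q < 1) :
    r * genFun q (q * r) = 1 := by
  have hr0 := hr.pos hq1
  refine (radius_mul_genFun_le_one hr hq0 hq1).antisymm ?_
  by_contra! hlt
  have hc : ContinuousAt (fun z => z * genFun q (q * z)) r :=
    continuousAt_id.mul (continuousAt_mul_genFun hr hq0 hq1)
  have hlin : ContinuousAt (fun z => q * z) r := by fun_prop
  have hev := (hc.eventually (gt_mem_nhds hlt)).and
    (hlin.eventually (gt_mem_nhds (mul_lt_of_lt_one_left hr0 hq1)))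
  obtain ⟨z, ⟨h1, h2⟩, hrz⟩ :=
    ((hev.filter_mono nhdsWithin_le_nhds).and (self_mem_nhdsWithin (s := Set.Ioi r))).exists
  have hz0 : 0 < z := hr0.trans hrz
  refine absurd (hr.le_of_bounded hq0.le hq1 hz0 (K := 1 / (1 - z * genFun q (q * z))) ?_)
    (not_le.2 hrz)
  intro n
  refine le_trans ?_ (sum_avoidSum_le hr hq0.le hq1 hz0.le h2 h1 (n + 1))
  refine Finset.single_le_sum (f := fun k => avoidSum q k * z ^ k) (fun k _ => ?_)
    (Finset.self_mem_range_succ n)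
  have := avoidSum_pos hq0.le k
  positivity

end GeneratingFunction

/-! ### Comparing `c` with the radius through nested iterates of `F`. -/

section Iterates

variable {q r : ℝ}

lemma F_coe_of_lt {x : ℝ} (h0 : 0 ≤ x) (h1 : x < 1) : F (x : EReal) = ((1 / (1 - x) : ℝ) : EReal) := by
  unfold F
  rw [if_pos ⟨by exact_mod_cast h0, by exact_mod_cast h1⟩, EReal.toReal_coe]

lemma F_coe_lt_top_iff {x : ℝ} : F (x : EReal) < ⊤ ↔ 0 ≤ x ∧ x < 1 := by
  constructor
  · intro h
    unfold F at h
    split_ifs at h with h'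
    · exact ⟨by exact_mod_cast h'.1, by exact_mod_cast h'.2⟩
    · exact absurd h (lt_irrefl _)
  · intro h
    rw [F_coe_of_lt h.1 h.2]
    exact EReal.coe_lt_top _

lemma F_top : F ⊤ = ⊤ := by
  simp [F]

lemma nestedF_top {c : ℝ} (hq0 : 0 < q) (hc : 0 < c) (N : ℕ) : nestedF q c N ⊤ = ⊤ := by
  induction N with
  | zero => rfl
  | succ N ih =>
    rw [nestedF, EReal.coe_mul_top_of_pos (by positivity), F_top, ih]

lemma nestedF_succ_of_lt {c x : ℝ} (N : ℕ) (h0 : 0 ≤ c * q ^ N * x) (h1 : c * q ^ N * x < 1) :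
    nestedF q c (N + 1) x = nestedF q c N ((1 / (1 - c * q ^ N * x) : ℝ) : EReal) := by
  rw [nestedF, ← EReal.coe_mul, F_coe_of_lt h0 h1]

lemma lt_one_of_nestedF_succ_lt_top {c x : ℝ} (hq0 : 0 < q) (hc : 0 < c) {N : ℕ}
    (h : nestedF q c (N + 1) x < ⊤) : 0 ≤ c * q ^ N * x ∧ c * q ^ N * x < 1 := by
  rw [nestedF, ← EReal.coe_mul] at h
  rw [← F_coe_lt_top_iff]
  by_contra hn
  rw [not_lt_top_iff.1 hn, nestedF_top hq0 hc] at h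
  exact absurd h (lt_irrefl _)

lemma nestedF_lt_top_mono {b c : ℝ} (hq0 : 0 < q) (hb : 0 < b) (hbc : b ≤ c) (N : ℕ) :
    ∀ {x y : ℝ}, 0 ≤ x → x ≤ y → nestedF q c N y < ⊤ → nestedF q b N x < ⊤ := by
  induction N with
  | zero => exact fun _ _ _ => EReal.coe_lt_top _
  | succ N ih =>
    intro x y hx hxy h
    obtain ⟨h0, h1⟩ := lt_one_of_nestedF_succ_lt_top hq0 (hb.trans_le hbc) h
    rw [nestedF_succ_of_lt N h0 h1] at h
    have hc := hb.trans_le hbc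
    have hle : b * q ^ N * x ≤ c * q ^ N * y := by gcongr
    rw [nestedF_succ_of_lt N (by positivity) (hle.trans_lt h1)]
    refine ih ?_ ?_ h
    · exact one_div_nonneg.2 (by linarith)
    · exact one_div_le_one_div_of_le (by linarith) (by linarith)

/-- The innermost `F` counts as one more level, leaving the seed `1/(1-q)`. -/
lemma upperIterate_eq (q c : ℝ) (N : ℕ) :
    upperIterate q c N = nestedF q c (N + 1) ((1 / (1 - q) : ℝ) : EReal) := by
  rw [upperIterate, nestedF, ← EReal.coe_mul]
  congr 3
  ring

lemma upperIterate_lt_top_mono {b c : ℝ} (hq0 : 0 < q) (hq1 : q < 1) (hb : 0 < b) (hbc : b ≤ c)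
    {N : ℕ} (h : upperIterate q c N < ⊤) : upperIterate q b N < ⊤ := by
  rw [upperIterate_eq] at h ⊢
  exact nestedF_lt_top_mono hq0 hb hbc _ (one_div_nonneg.2 (by linarith)) le_rfl h

/-- By the functional equation and monotonicity of `F`, staying strictly below `G` passes from each
level to the next one outward. At the outermost level `c G(qc) ≤ 1` suffices, so `c = r` is allowed.
-/
lemma nestedF_succ_lt_top (hr : IsRadius q r) (hq0 : 0 < q) (hq1 : q < 1) {c : ℝ} (hc0 : 0 < c)
    (hcr : c ≤ r) (N : ℕ) : ∀ {x : ℝ}, 0 ≤ x → x < genFun q (c * q ^ (N + 1)) →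
      nestedF q c (N + 1) x < ⊤ := by
  induction N with
  | zero =>
    intro x hx h
    have h1 : c * q ^ 0 * x < 1 := by
      calc c * q ^ 0 * x < c * genFun q (q * c) := by
            rw [pow_zero, mul_one]
            refine mul_lt_mul_of_pos_left ?_ hc0
            simpa [mul_comm] using h
        _ ≤ 1 := by
            rcases hcr.lt_or_eq with h | h
            · exact (mul_genFun_lt_one hr hq0.le hq1 hc0.le h).le
            · rw [h]
              exact radius_mul_genFun_le_one hr hq0 hq1
    rw [nestedF_succ_of_lt 0 (by positivity) h1]
    exact EReal.coe_lt_top _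
  | succ N ih =>
    intro x hx h
    have hz : c * q ^ (N + 1) < r :=
      (mul_lt_of_lt_one_right hc0 (pow_lt_one₀ hq0.le hq1 (by omega))).trans_le hcr
    have hz0 : 0 < c * q ^ (N + 1) := by positivity
    have hg := mul_genFun_lt_one hr hq0.le hq1 hz0.le hz
    have hG := genFun_eq_div hr hq0.le hq1 hz0.le hz
    have he : q * (c * q ^ (N + 1)) = c * q ^ (N + 1 + 1) := by ring
    rw [he] at hg hG
    have hlt : c * q ^ (N + 1) * x < c * q ^ (N + 1) * genFun q (c * q ^ (N + 1 + 1)) := by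
      gcongr
    rw [nestedF_succ_of_lt (N + 1) (by positivity) (hlt.trans hg)]
    refine ih (one_div_nonneg.2 (by linarith)) ?_
    rw [hG]
    exact one_div_lt_one_div_of_lt (by linarith) (by linarith)

lemma lowerIterate_lt_top (hr : IsRadius q r) (hq0 : 0 < q) (hq1 : q < 1) {c : ℝ} (hc0 : 0 < c)
    (hcr : c ≤ r) {N : ℕ} (hN : 1 ≤ N) : lowerIterate q c N < ⊤ := by
  obtain ⟨N, rfl⟩ := Nat.exists_eq_add_of_le' hN
  refine nestedF_succ_lt_top hr hq0 hq1 hc0 hcr N (by positivity) ?_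
  exact one_add_lt_genFun hr hq0.le hq1 (by positivity)
    ((mul_lt_of_lt_one_right hc0 (pow_lt_one₀ hq0.le hq1 (by omega))).trans_le hcr)

/-- On `[0, 1)` the slope of `F` is at least 1, so an excess in the argument survives undiminished.
-/
lemma add_le_one_div_one_sub {u v : ℝ} (hu : 0 ≤ u) (hv : 0 ≤ v) (h : u + v < 1) :
    1 / (1 - u) + v ≤ 1 / (1 - (u + v)) := by
  rw [div_add' _ _ _ (by linarith), div_le_div_iff₀ (by linarith) (by linarith)]
  nlinarith [mul_nonneg hu hv, mul_nonneg hv hv, mul_nonneg hv (sub_nonneg.2 h.le),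
    mul_nonneg (mul_nonneg hu hv) (sub_nonneg.2 h.le)]

/-- An excess `ε` of the seed over `G` is multiplied by `b * q ^ i` at level `i` and not reduced by
`F`; the product collects these factors. -/
lemma mul_genFun_add_lt_one (hr : IsRadius q r) (hq0 : 0 < q) (hq1 : q < 1) {b : ℝ} (hb0 : 0 < b)
    (hbr : b < r) (N : ℕ) : ∀ {x ε : ℝ}, 0 ≤ ε → genFun q (b * q ^ (N + 1)) + ε ≤ x →
      nestedF q b (N + 1) x < ⊤ →
      b * genFun q (q * b) + ε * ∏ i ∈ Finset.range (N + 1), (b * q ^ i) < 1 := by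
  induction N with
  | zero =>
    intro x ε hε hx h
    have h1 := (lt_one_of_nestedF_succ_lt_top hq0 hb0 h).2
    have he : q * b = b * q ^ (0 + 1) := by ring
    rw [he]
    simp only [pow_zero, mul_one, Finset.range_one, Finset.prod_singleton, zero_add] at h1 hx ⊢
    nlinarith
  | succ N ih =>
    intro x ε hε hx h
    have hz : b * q ^ (N + 1) < r :=
      (mul_le_of_le_one_right hb0.le (pow_le_one₀ hq0.le hq1.le)).trans_lt hbr
    have hz0 : 0 < b * q ^ (N + 1) := by positivity
    obtain ⟨h0, h1⟩ := lt_one_of_nestedF_succ_lt_top hq0 hb0 h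
    rw [nestedF_succ_of_lt (N + 1) h0 h1] at h
    have hG := genFun_eq_div hr hq0.le hq1 hz0.le hz
    have he : q * (b * q ^ (N + 1)) = b * q ^ (N + 1 + 1) := by ring
    rw [he] at hG
    have hg1 : 0 ≤ genFun q (b * q ^ (N + 1 + 1)) := by
      rw [← he]
      refine zero_le_one.trans (one_le_genFun hr hq0.le hq1 (by positivity) ?_)
      exact (mul_le_of_le_one_left hz0.le hq1.le).trans_lt hz
    have hle : b * q ^ (N + 1) * genFun q (b * q ^ (N + 1 + 1)) + b * q ^ (N + 1) * ε
        ≤ b * q ^ (N + 1) * x := by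
      rw [← mul_add]
      gcongr
    have := ih (ε := b * q ^ (N + 1) * ε) (by positivity) ?_ h
    · rw [Finset.prod_range_succ]
      refine lt_of_eq_of_lt ?_ this
      ring
    · rw [hG]
      refine (add_le_one_div_one_sub (by positivity) (by positivity) (hle.trans_lt h1)).trans ?_
      exact one_div_le_one_div_of_le (by linarith) (by linarith)

lemma lt_radius_of_upperIterate (hr : IsRadius q r) (hq0 : 0 < q) (hq1 : q < 1) {c : ℝ}
    {N : ℕ} (hN : 1 ≤ N)
    (h : ∀ a : ℝ, a < c → ∃ b : ℝ, a < b ∧ b < c ∧ upperIterate q b N < ⊤) : c < r := by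
  by_contra! hrc
  have hr0 := hr.pos hq1
  have hup : ∀ b, 0 < b → b < r → upperIterate q b N < ⊤ := fun b hb hbr => by
    obtain ⟨b', h1, _, h3⟩ := h b (hbr.trans_le hrc)
    exact upperIterate_lt_top_mono hq0 hq1 hb h1.le h3
  have hqr : q * r < r := mul_lt_of_lt_one_left hr0 hq1
  -- Since `N ≥ 1`, the point `r * q ^ (N + 1)` lies strictly below `q * r`, where `G` equals `1 /
  -- r`.
  have hlt : genFun q (r * q ^ (N + 1)) < 1 / (1 - q) := by
    calc genFun q (r * q ^ (N + 1)) < genFun q (q * r) := by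
          refine genFun_lt_genFun hr hq0.le hq1 (by positivity) ?_ hqr
          rw [pow_succ, mul_comm q r, mul_comm _ q, ← mul_assoc]
          exact mul_lt_of_lt_one_right (by positivity) (pow_lt_one₀ hq0.le hq1 (by omega))
      _ = 1 / r := by
          rw [eq_div_iff hr0.ne', mul_comm]
          exact radius_mul_genFun hr hq0 hq1
      _ ≤ 1 / (1 - q) := one_div_le_one_div_of_le (by linarith) hr.one_sub_le
  -- Taken at `r`, this excess serves every `b < r`, so it survives the limit `b → r`.
  set ε := 1 / (1 - q) - genFun q (r * q ^ (N + 1)) with hε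
  have hε0 : 0 < ε := sub_pos.2 hlt
  have hmain : r * genFun q (q * r) + ε * ∏ i ∈ Finset.range (N + 1), (r * q ^ i) ≤ 1 := by
    refine le_one_of_frequently_lt (f := fun b => b * genFun q (q * b)
      + ε * ∏ i ∈ Finset.range (N + 1), (b * q ^ i)) ?_
      (frequently_nhds_of_lt hr0 fun b hb hbr => ?_)
    · refine (continuousAt_id.mul (continuousAt_mul_genFun hr hq0 hq1)).add ?_
      exact Continuous.continuousAt (by fun_prop)
    · refine mul_genFun_add_lt_one hr hq0 hq1 hb hbr N hε0.le ?_
        ((upperIterate_eq q b N) ▸ hup b hb hbr)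
      have := genFun_le_genFun hr hq0.le hq1 (w := b * q ^ (N + 1)) (z := r * q ^ (N + 1))
        (by positivity) (by gcongr)
        (mul_lt_of_lt_one_right hr0 (pow_lt_one₀ hq0.le hq1 (by omega)))
      linarith
  rw [radius_mul_genFun hr hq0 hq1] at hmain
  have : 0 < ε * ∏ i ∈ Finset.range (N + 1), (r * q ^ i) :=
    mul_pos hε0 (Finset.prod_pos fun i _ => by positivity)
  linarith

end Iterates

end MallowsPattern

theorem theorem3 (q : ℝ) (hq0 : 0 < q) (hq1 : q < 1) :
    ∃ L : ℝ,
      Tendsto (fun n : ℕ =>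
        (MallowsPattern.mallowsProb n q
          (MallowsPattern.avoiders n MallowsPattern.perm312)) ^ ((1 : ℝ) / (n : ℝ)))
        atTop (𝓝 L) ∧
      Tendsto (fun n : ℕ =>
        (MallowsPattern.mallowsProb n q
          (MallowsPattern.avoiders n MallowsPattern.perm231)) ^ ((1 : ℝ) / (n : ℝ)))
        atTop (𝓝 L) ∧
      (∀ c : ℝ, 0 < c → c ≤ 1 →
        (∃ N : ℕ, 1 ≤ N ∧ MallowsPattern.lowerIterate q c N = ⊤) →
        (1 - q) / c < L) ∧
      (∀ c : ℝ, 0 < c → c < 1 →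
        (∃ N : ℕ, 1 ≤ N ∧ MallowsPattern.upperIterate q c N < ⊤) →
        L < (1 - q) / c) ∧
      (∀ c : ℝ, 0 < c → c < 1 →
        (∃ N : ℕ, 1 ≤ N ∧
          ∀ a : ℝ, a < c → ∃ b : ℝ, a < b ∧ b < c ∧ MallowsPattern.upperIterate q b N < ⊤) →
        L < (1 - q) / c) := by
  obtain ⟨r, hr⟩ := MallowsPattern.exists_isRadius hq0.le hq1
  have hr0 := hr.pos hq1
  have hq : 0 < 1 - q := by linarith
  refine ⟨(1 - q) / r, ?_, ?_, ?_, ?_, ?_⟩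
  · simpa only [MallowsPattern.mallowsProb_perm312] using hr.tendsto_prob hq0.le hq1
  · simpa only [MallowsPattern.mallowsProb_perm231] using hr.tendsto_prob hq0.le hq1
  · rintro c hc0 - ⟨N, hN, h⟩
    refine div_lt_div_of_pos_left hq hr0 ?_
    by_contra! hcr
    exact (MallowsPattern.lowerIterate_lt_top hr hq0 hq1 hc0 hcr hN).ne h
  · rintro c hc0 - ⟨N, hN, h⟩
    refine div_lt_div_of_pos_left hq hc0
      (MallowsPattern.lt_radius_of_upperIterate hr hq0 hq1 hN fun a ha => ?_)
    -- The maximum with 0 keeps `b` positive, as monotonicity in `c` requires.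
    obtain ⟨b, hb1, hb2⟩ := exists_between (max_lt ha hc0)
    exact ⟨b, (le_max_left _ _).trans_lt hb1, hb2,
      MallowsPattern.upperIterate_lt_top_mono hq0 hq1 ((le_max_right _ _).trans_lt hb1) hb2.le h⟩
  · rintro c hc0 - ⟨N, hN, h⟩
    exact div_lt_div_of_pos_left hq hc0
      (MallowsPattern.lt_radius_of_upperIterate hr hq0 hq1 hN h)
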